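/- Let $n\ge 0$ and $N>n$ be integers and let $K$ be a field of characteristic $0$ (for example $\mathbb{Q}$, $\mathbb{R}$ or $\mathbb{C}$). Let $SP_n(N)$ be the space of symmetric polynomials in $x_1,\dots,x_N$ over $K$ that are homogeneous of degree $n$. For a partition $\lambda$ of $n$, let $p_\lambda$ be the power sum symmetric polynomial, that is, the product over the parts $k$ of $\lambda$ (with multiplicity) of $p_k=\sum_{i=1}^N x_i^k$. Let $A_n$ be the square matrix with rows and columns indexed by the partitions of $n$ whose entry $(A_n)_{\lambda\sigma}$ in row $\lambda$ and column $\sigma$ is the number of transpositions $\pi\in S_n$ such that $\pi\alpha$ has cycle type $\sigma$, where $\alpha\in S_n$ is any fixed permutation of cycle type $\lambda$ (the number does not depend on the choice of $\alpha$). Let $$D^*=\sum_{i=1}^N x_i^2\frac{\partial^2}{\partial x_i^2}+\sum_{1\le i\ne j\le N}\frac{1}{x_i-x_j}\left(x_i^2\frac{\partial}{\partial x_i}-x_j^2\frac{\partial}{\partial x_j}\right),$$ where the second sum is over ordered pairs $(i,j)$. Then $\{p_\lambda\}_{\lambda\vdash n}$ is a basis of $SP_n(N)$, the operator $D^*$ maps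 $SP_n(N)$ into itself, and the matrix of $\tfrac12 D^*$ on $SP_n(N)$ with respect to this basis (the column with index $\lambda$ holds the coordinates of $\tfrac12D^*p_\lambda$) is $$A_n^{T}+n(N-1)\,I,$$ that is, for every partition $\lambda$ of $n$, $$\tfrac12 D^*p_\lambda=n(N-1)\,p_\lambda+\sum_{\sigma\vdash n}(A_n)_{\lambda\sigma}\,p_\sigma .$$ -/

import Mathlib

/-- The cycle type of a permutation of `n` objects as a partition of `n`
(fixed points are parts equal to `1`). -/
def cyclePartition {n : ℕ} (α : Equiv.Perm (Fin n)) : n.Partition where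
  parts := α.partition.parts
  parts_pos := fun h => α.partition.parts_pos h
  parts_sum := by simpa using α.partition.parts_sum

theorem cyclePartition_eq_iff {n : ℕ} {α β : Equiv.Perm (Fin n)} :
    cyclePartition α = cyclePartition β ↔ IsConj α β := by
  rw [Equiv.Perm.partition_eq_of_isConj, Nat.Partition.ext_iff, Nat.Partition.ext_iff]
  rfl

/-- Every partition of `n` is the cycle type of some permutation. -/
theorem exists_cyclePartition_eq {n : ℕ} (l : n.Partition) :
    ∃ α : Equiv.Perm (Fin n), cyclePartition α = l := by
  have hsplit : l.parts.filter (fun k => 2 ≤ k) + l.parts.filter (fun k => ¬ 2 ≤ k) = l.parts :=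
    Multiset.filter_add_not _ _
  have hone : l.parts.filter (fun k => ¬ 2 ≤ k) =
      Multiset.replicate (l.parts.filter (fun k => ¬ 2 ≤ k)).card 1 := by
    rw [Multiset.eq_replicate]
    refine ⟨rfl, fun b hb => ?_⟩
    rw [Multiset.mem_filter] at hb
    have := l.parts_pos hb.1
    omega
  have hsum : (l.parts.filter (fun k => 2 ≤ k)).sum
      + (l.parts.filter (fun k => ¬ 2 ≤ k)).card = n := by
    have h := congrArg Multiset.sum hsplit
    rw [hone, Multiset.sum_add, Multiset.sum_replicate, l.parts_sum, smul_eq_mul, mul_one] at h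
    exact h
  obtain ⟨α, hα⟩ := (Equiv.Perm.exists_with_cycleType_iff (Fin n)
    (m := l.parts.filter (fun k => 2 ≤ k))).2
    ⟨by rw [Fintype.card_fin]; omega, fun a ha => (Multiset.mem_filter.1 ha).2⟩
  refine ⟨α, Nat.Partition.ext ?_⟩
  change α.partition.parts = l.parts
  rw [Equiv.Perm.parts_partition, ← Equiv.Perm.sum_cycleType, hα, Fintype.card_fin]
  conv_rhs => rw [← hsplit, hone]
  congr 2
  omega

/-- The number of transpositions `π` that take the permutation `α` to a permutation `π α` of cycle
type `s`. -/
noncomputable def transpositionCount {n : ℕ} (α : Equiv.Perm (Fin n)) (s : n.Partition) : ℕ :=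
  Nat.card {π : Equiv.Perm (Fin n) // π.IsSwap ∧ cyclePartition (π * α) = s}

/-- `transpositionCount α s` depends only on the cycle type of `α`. -/
theorem transpositionCount_eq {n : ℕ} {α β : Equiv.Perm (Fin n)}
    (h : cyclePartition α = cyclePartition β) (s : n.Partition) :
    transpositionCount α s = transpositionCount β s := by
  obtain ⟨c, hc⟩ := isConj_iff.1 (cyclePartition_eq_iff.1 h)
  refine Nat.card_congr ((MulAut.conj c).toEquiv.subtypeEquiv fun π => ?_)
  have h1 : (c * π * c⁻¹).IsSwap ↔ π.IsSwap := by
    rw [Equiv.Perm.isSwap_iff_cycleType, Equiv.Perm.isSwap_iff_cycleType,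
      Equiv.Perm.cycleType_conj]
  have h2 : cyclePartition (c * π * c⁻¹ * β) = cyclePartition (π * α) := by
    rw [cyclePartition_eq_iff, isConj_comm, isConj_iff]
    exact ⟨c, by rw [← hc]; group⟩
  change _ ↔ (c * π * c⁻¹).IsSwap ∧ cyclePartition (c * π * c⁻¹ * β) = s
  rw [h1, h2]

/-- The matrix `A_n`: the entry in row `l` and column `s` is the number of transpositions taking a
(by `transpositionMatrix_apply`: any) permutation of cycle type `l` to a permutation of cycle
type `s`. -/
noncomputable def transpositionMatrix (n : ℕ) : Matrix n.Partition n.Partition ℕ :=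
  Matrix.of fun l s => transpositionCount (exists_cyclePartition_eq l).choose s

theorem transpositionMatrix_apply {n : ℕ} (α : Equiv.Perm (Fin n)) (s : n.Partition) :
    transpositionMatrix n (cyclePartition α) s = transpositionCount α s :=
  transpositionCount_eq (exists_cyclePartition_eq (cyclePartition α)).choose_spec s

/-- The space of symmetric polynomials in `N` variables, homogeneous of degree `n`. -/
noncomputable def symmetricHomogeneous (K : Type*) [Field K] (N n : ℕ) :
    Submodule K (MvPolynomial (Fin N) K) :=
  Subalgebra.toSubmodule (MvPolynomial.symmetricSubalgebra (Fin N) K) ⊓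
    MvPolynomial.homogeneousSubmodule (Fin N) K n

open MvPolynomial in
/-- The operator
`D* = ∑ᵢ xᵢ² ∂ᵢ² + ∑_{i ≠ j} (xᵢ - xⱼ)⁻¹ (xᵢ² ∂ᵢ - xⱼ² ∂ⱼ)`
(the second sum is over ordered pairs), applied to a polynomial in `N` variables. Its value is a
priori a rational function. -/
noncomputable def dStar {K : Type*} [Field K] {N : ℕ} (f : MvPolynomial (Fin N) K) :
    FractionRing (MvPolynomial (Fin N) K) :=
  (∑ i : Fin N, algebraMap (MvPolynomial (Fin N) K) (FractionRing (MvPolynomial (Fin N) K))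
      (X i ^ 2 * pderiv i (pderiv i f))) +
  ∑ i : Fin N, ∑ j : Fin N, if i = j then 0 else
    algebraMap (MvPolynomial (Fin N) K) (FractionRing (MvPolynomial (Fin N) K))
      (X i ^ 2 * pderiv i f - X j ^ 2 * pderiv j f) /
    algebraMap (MvPolynomial (Fin N) K) (FractionRing (MvPolynomial (Fin N) K)) (X i - X j)

/-!
The proof evaluates `D*` on a power sum product through an expansion in which permutations act.
For a permutation `α` of `n` objects, let `W(α) = invariantSum K N α` be the sum of the monomials
`∏ₖ x_{f k}` over all colourings `f` of the objects by `1, …, N` that are constant on the cycles of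
`α`. Colouring the cycles independently shows that `W(α)` is the power sum product of the cycle
type of `α` (`invariantSum_eq_psumPart`). So the claim about `D*` is
`D* W(α) = 2 n (N - 1) W(α) + ∑_{a ≠ b} W((a b) α)` (`dStar_invariantSum`), where every
transposition occurs twice on the right.

The colourings counted by `W((a b) α)` are of two kinds. Those with `f a = f b` are constant on the
cycles of `α` too, and summed over `a ≠ b` they give `∑ᵢ xᵢ² ∂ᵢ² W(α)`, as `xᵢ² ∂ᵢ²` counts the
ordered pairs of distinct objects coloured by `i`. Those with `f a = i` and `f b = j` for
`i ≠ j` colour the cycle of `α` through `a` and `b` by two arcs, of colours `i` and `j`. Write `Z_b`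
for their sum and `W_i` for the part of `W(α)` with `f a = i`. Recolouring `b` moves the end of the
first arc from `b` to `α b`, so `xᵢ Z_b = xⱼ Z_{α b}`; the chain starts at `W_j` and ends at `W_i`
(and `Z_b = 0` if `b` is not on the cycle of `a`).
The sum over `b` telescopes (`X_mul_pinnedSum_sub`) to
`xᵢ W_i - xⱼ W_j = (xᵢ - xⱼ) (W_i + W_j + ∑_b Z_b)`. Its left side, summed over `a`, is
`(xᵢ² ∂ᵢ - xⱼ² ∂ⱼ) W(α)`. So the quotients in `D*` are polynomials; the terms `Z_b` complete the
sum of the `W((a b) α)`, and `W_i + W_j`, summed over `i ≠ j` and over `a`, gives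
`2 n (N - 1) W(α)`.

For the basis, Newton's identities and the fundamental theorem of symmetric polynomials show that
the power sum products span (`symmetricHomogeneous_le_psumSpan`). They are independent because
there are as many of them as there are products of elementary symmetric polynomials of the same
degree, and the latter are independent when `n ≤ N` (`linearIndependent_psumPart`).
-/

open Finset MvPolynomial

/-! ### The basis of power sum products -/

/-- The span of the power sum products `p_l`, for `l` a partition of `n`. -/
noncomputable def psumSpan (K : Type*) [Field K] (N n : ℕ) : Submodule K (MvPolynomial (Fin N) K) :=
  Submodule.span K (Set.range fun l : n.Partition => psumPart (Fin N) K l)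

section Basis

variable {K : Type*} [Field K] {N : ℕ}

theorem multiset_prod_psum_mem_psumSpan (s : Multiset ℕ) (hs : ∀ k ∈ s, 0 < k) :
    (s.map (psum (Fin N) K)).prod ∈ psumSpan K N s.sum :=
  Submodule.subset_span ⟨⟨s, fun h => hs _ h, rfl⟩, rfl⟩

theorem psum_mem_psumSpan {k : ℕ} (hk : 0 < k) : psum (Fin N) K k ∈ psumSpan K N k := by
  simpa using multiset_prod_psum_mem_psumSpan (K := K) (N := N) {k} (by simpa using hk)

theorem one_mem_psumSpan : (1 : MvPolynomial (Fin N) K) ∈ psumSpan K N 0 := by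
  simpa using multiset_prod_psum_mem_psumSpan (K := K) (N := N) 0 (by simp)

theorem mul_mem_psumSpan {a b : ℕ} {f g : MvPolynomial (Fin N) K}
    (hf : f ∈ psumSpan K N a) (hg : g ∈ psumSpan K N b) : f * g ∈ psumSpan K N (a + b) := by
  have h := Submodule.mul_mem_mul hf hg
  rw [psumSpan, psumSpan, Submodule.span_mul_span] at h
  refine Submodule.span_le.2 ?_ h
  rintro _ ⟨_, ⟨l, rfl⟩, _, ⟨m, rfl⟩, rfl⟩
  have h := multiset_prod_psum_mem_psumSpan (K := K) (N := N) (l.parts + m.parts) (fun k hk => by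
    rcases Multiset.mem_add.1 hk with hk | hk
    exacts [l.parts_pos hk, m.parts_pos hk])
  rw [Multiset.map_add, Multiset.prod_add, Multiset.sum_add, l.parts_sum, m.parts_sum] at h
  exact h

theorem pow_mem_psumSpan {a : ℕ} {f : MvPolynomial (Fin N) K}
    (hf : f ∈ psumSpan K N a) (m : ℕ) : f ^ m ∈ psumSpan K N (m * a) := by
  induction m with
  | zero => simpa using one_mem_psumSpan
  | succ m ih => rw [pow_succ, add_mul, one_mul]; exact mul_mem_psumSpan ih hf

theorem prod_mem_psumSpan {ι : Type*} (s : Finset ι) (d : ι → ℕ) (f : ι → MvPolynomial (Fin N) K)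
    (h : ∀ i ∈ s, f i ∈ psumSpan K N (d i)) : ∏ i ∈ s, f i ∈ psumSpan K N (∑ i ∈ s, d i) := by
  classical
  induction s using Finset.induction_on with
  | empty => simpa using one_mem_psumSpan
  | insert a s ha ih =>
    rw [prod_insert ha, sum_insert ha]
    exact mul_mem_psumSpan (h a (mem_insert_self a s)) (ih fun i hi => h i (mem_insert_of_mem hi))

/-- Newton's identities, solved for the elementary symmetric polynomials. -/
theorem esymm_mem_psumSpan [CharZero K] (k : ℕ) : esymm (Fin N) K k ∈ psumSpan K N k := by
  induction k using Nat.strong_induction_on with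
  | _ k ih =>
    rcases Nat.eq_zero_or_pos k with rfl | hk
    · simpa using one_mem_psumSpan
    have hk' : (k : K) ≠ 0 := Nat.cast_ne_zero.2 hk.ne'
    have key : (k : K) • esymm (Fin N) K k ∈ psumSpan K N k := by
      have hcast : (k : K) • esymm (Fin N) K k = k * esymm (Fin N) K k := by
        rw [smul_eq_C_mul, map_natCast]
      have hneg (m : ℕ) (f : MvPolynomial (Fin N) K) : (-1) ^ m * f = ((-1 : K) ^ m) • f := by
        rw [smul_eq_C_mul, map_pow, map_neg, map_one]
      rw [hcast, mul_esymm_eq_sum, hneg]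
      refine Submodule.smul_mem _ _ (Submodule.sum_mem _ fun a ha => ?_)
      rw [mem_filter, HasAntidiagonal.mem_antidiagonal] at ha
      rw [mul_assoc, hneg]
      refine Submodule.smul_mem _ _ ?_
      have h := mul_mem_psumSpan (ih a.1 ha.2)
        (psum_mem_psumSpan (K := K) (N := N) (k := a.2) (by omega))
      rwa [ha.1] at h
    simpa [smul_smul, hk'] using Submodule.smul_mem _ (k : K)⁻¹ key

theorem isHomogeneous_psumPart {n : ℕ} (l : n.Partition) :
    (psumPart (Fin N) K l).IsHomogeneous n := by
  have h (s : Multiset ℕ) : ((s.map (psum (Fin N) K)).prod).IsHomogeneous s.sum := by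
    induction s using Multiset.induction_on with
    | empty => simpa using isHomogeneous_one (Fin N) K
    | cons k s ih =>
      rw [Multiset.map_cons, Multiset.prod_cons, Multiset.sum_cons]
      refine IsHomogeneous.mul (IsHomogeneous.sum _ _ _ fun i _ => ?_) ih
      simpa using (isHomogeneous_X K i).pow k
  have := h l.parts
  rwa [l.parts_sum] at this

theorem psumPart_mem_symmetricHomogeneous {n : ℕ} (l : n.Partition) :
    psumPart (Fin N) K l ∈ symmetricHomogeneous K N n := by
  refine ⟨?_, (mem_homogeneousSubmodule _ _).2 (isHomogeneous_psumPart l)⟩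
  refine Subalgebra.multiset_prod_mem (symmetricSubalgebra (Fin N) K) fun f hf => ?_
  obtain ⟨k, -, rfl⟩ := Multiset.mem_map.1 hf
  exact psum_isSymmetric _ _ k

theorem psumSpan_le_symmetricHomogeneous (n : ℕ) :
    psumSpan K N n ≤ symmetricHomogeneous K N n :=
  Submodule.span_le.2 (by rintro _ ⟨l, rfl⟩; exact psumPart_mem_symmetricHomogeneous l)

/-- A symmetric polynomial is a combination of products of elementary symmetric polynomials, each
of which lies in one of the graded pieces `psumSpan K N w`; taking the component of degree `n`
leaves only the piece `w = n`. -/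
theorem symmetricHomogeneous_le_psumSpan [CharZero K] (n : ℕ) :
    symmetricHomogeneous K N n ≤ psumSpan K N n := by
  rintro f ⟨hsymm, hhom⟩
  replace hhom := (mem_homogeneousSubmodule _ _).1 hhom
  obtain ⟨q, hq⟩ := esymmAlgHom_surjective (σ := Fin N) (R := K) (n := N) (by simp) ⟨f, hsymm⟩
  have hf : f = aeval (fun i : Fin N ↦ esymm (Fin N) K (i + 1)) q := by
    rw [← esymmAlgHom_apply, hq]
  have hcomp : homogeneousComponent n f = f := by
    rw [homogeneousComponent_of_mem hhom, if_pos rfl]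
  rw [← hcomp, hf, aeval_def, eval₂_eq, map_sum]
  refine Submodule.sum_mem _ fun d _ => ?_
  rw [algebraMap_eq, ← smul_eq_C_mul, map_smul]
  refine Submodule.smul_mem _ _ ?_
  have hmem := prod_mem_psumSpan d.support (fun i => d i * (i + 1))
    (fun i : Fin N => esymm (Fin N) K (i + 1) ^ d i)
    fun i _ => pow_mem_psumSpan (esymm_mem_psumSpan _) _
  rw [homogeneousComponent_of_mem (psumSpan_le_symmetricHomogeneous _ hmem).2]
  split_ifs with h
  · rwa [← h] at hmem
  · exact Submodule.zero_mem _

/-- The products `e_l` of elementary symmetric polynomials are the images of pairwise distinct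
monomials under an injective algebra homomorphism. -/
theorem linearIndependent_esymmPart {n : ℕ} (hN : n ≤ N) :
    LinearIndependent K fun l : n.Partition => esymmPart (Fin N) K l := by
  -- The exponent at `i` is the multiplicity of the part `i + 1`: the variable with index `i` maps
  -- to the elementary symmetric polynomial of degree `i + 1`.
  let c (l : n.Partition) : Fin N →₀ ℕ :=
    Finsupp.equivFunOnFinite.symm fun i => l.parts.count ((i : ℕ) + 1)
  have hle {l : n.Partition} {k : ℕ} (hk : k ∈ l.parts) : k ≤ n :=
    l.parts_sum ▸ Multiset.le_sum_of_mem hk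
  have hc : Function.Injective c := by
    intro l m h
    refine Nat.Partition.ext (Multiset.ext.2 fun k => ?_)
    by_cases hk : 0 < k ∧ k ≤ N
    · have := DFunLike.congr_fun h ⟨k - 1, by omega⟩
      simpa [c, Nat.sub_add_cancel hk.1] using this
    · have hnot (l : n.Partition) : k ∉ l.parts := fun h =>
        hk ⟨l.parts_pos h, (hle h).trans hN⟩
      rw [Multiset.count_eq_zero_of_notMem (hnot l), Multiset.count_eq_zero_of_notMem (hnot m)]
  have hlin : LinearIndependent K fun l : n.Partition => monomial (c l) (1 : K) := by
    simpa [Function.comp_def] using (basisMonomials (Fin N) K).linearIndependent.comp c hc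
  let Φ : MvPolynomial (Fin N) K →ₐ[K] MvPolynomial (Fin N) K :=
    aeval fun i : Fin N ↦ esymm (Fin N) K (i + 1)
  have hΦ : Function.Injective Φ := fun p q h => by
    apply esymmAlgHom_injective (σ := Fin N) K (n := N) (by simp)
    refine Subtype.ext ?_
    rw [esymmAlgHom_apply, esymmAlgHom_apply]
    exact h
  have heq : (fun l : n.Partition => esymmPart (Fin N) K l) =
      Φ.toLinearMap ∘ fun l => monomial (c l) (1 : K) := by
    funext l
    simp only [Function.comp_apply, AlgHom.toLinearMap_apply, Φ, aeval_monomial, map_one, one_mul]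
    rw [Finsupp.prod_fintype _ _ (by simp), esymmPart, prod_multiset_map_count]
    symm
    refine prod_bij_ne_one (fun i _ _ => (i : ℕ) + 1) ?_ ?_ ?_ ?_
    · intro i _ h
      rw [Multiset.mem_toFinset, ← Multiset.count_ne_zero]
      intro h0
      exact h (by simp [c, h0])
    · intro i _ _ j _ _ h
      exact Fin.ext (by simpa using h)
    · intro k hk _
      rw [Multiset.mem_toFinset] at hk
      have h1 := l.parts_pos hk
      have h2 := hle hk
      refine ⟨⟨k - 1, by omega⟩, mem_univ _, ?_, Nat.sub_add_cancel h1⟩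
      simpa [c, Nat.sub_add_cancel h1]
    · intro i _ _
      simp [c]
  rw [heq]
  exact hlin.map' Φ.toLinearMap (LinearMap.ker_eq_bot.2 hΦ)

theorem esymmPart_mem_psumSpan [CharZero K] {n : ℕ} (l : n.Partition) :
    esymmPart (Fin N) K l ∈ psumSpan K N n := by
  have h (s : Multiset ℕ) : (s.map (esymm (Fin N) K)).prod ∈ psumSpan K N s.sum := by
    induction s using Multiset.induction_on with
    | empty => simpa using one_mem_psumSpan
    | cons k s ih =>
      rw [Multiset.map_cons, Multiset.prod_cons, Multiset.sum_cons]
      exact mul_mem_psumSpan (esymm_mem_psumSpan k) ih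
  have := h l.parts
  rwa [l.parts_sum] at this

/-- The power sum products span the space, which contains as many linearly independent
elements `e_l`; so they are linearly independent themselves. -/
theorem linearIndependent_psumPart [CharZero K] {n : ℕ} (hN : n ≤ N) :
    LinearIndependent K fun l : n.Partition => psumPart (Fin N) K l := by
  rw [linearIndependent_iff_card_le_finrank_span]
  have : FiniteDimensional K (psumSpan K N n) :=
    FiniteDimensional.span_of_finite K (Set.finite_range _)
  have he : LinearIndependent K fun l : n.Partition =>
      (⟨_, esymmPart_mem_psumSpan l⟩ : psumSpan K N n) :=
    LinearIndependent.of_comp (psumSpan K N n).subtype (linearIndependent_esymmPart hN)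
  exact he.fintype_card_le_finrank

/-- The power sum products as a basis of the symmetric homogeneous polynomials. -/
noncomputable def psumBasis (K : Type*) [Field K] [CharZero K] {N n : ℕ} (hN : n ≤ N) :
    Module.Basis n.Partition K (symmetricHomogeneous K N n) :=
  (Module.Basis.span (linearIndependent_psumPart (K := K) hN)).map
    (LinearEquiv.ofEq _ _ (le_antisymm (psumSpan_le_symmetricHomogeneous (K := K) (N := N) n)
      (symmetricHomogeneous_le_psumSpan n)))

theorem coe_psumBasis [CharZero K] {n : ℕ} (hN : n ≤ N) (l : n.Partition) :
    (psumBasis K hN l : MvPolynomial (Fin N) K) = psumPart (Fin N) K l := by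
  simp [psumBasis, Module.Basis.span_apply]

end Basis

/-! ### Power sum products as sums over colourings of cycles -/

section Orbits

variable {ι : Type*} [Fintype ι] [DecidableEq ι]

/-- A product over the parts of the partition of a permutation is a product over its orbits. -/
theorem prod_map_parts_partition {M : Type*} [CommMonoid M] (α : Equiv.Perm ι) (F : ℕ → M)
    [Fintype (Quotient (Equiv.Perm.SameCycle.setoid α))]
    [DecidableEq (Quotient (Equiv.Perm.SameCycle.setoid α))] :
    (α.partition.parts.map F).prod =
      ∏ o : Quotient (Equiv.Perm.SameCycle.setoid α), F #{k | Quotient.mk _ k = o} := by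
  let q : ι → Quotient (Equiv.Perm.SameCycle.setoid α) := Quotient.mk _
  have hq {x y : ι} : q x = q y ↔ α.SameCycle x y := Quotient.eq
  -- The parts equal to `1` that `partition` adds to `cycleType` are the singleton orbits.
  have hfix : ∏ x ∈ univ \ α.support, F 1 =
      ∏ o with ∃ x, q x = o ∧ α x = x, F #{k | q k = o} := by
    refine prod_bij (fun x _ => q x) ?_ ?_ ?_ ?_
    · intro x hx
      have hx : α x = x := by simpa using hx
      simpa using ⟨x, rfl, hx⟩
    · intro x hx y hy h
      have hx : α x = x := by simpa using hx
      exact ((Equiv.Perm.SameCycle.eq_of_left (hq.1 h)) hx)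
    · rintro o ho
      obtain ⟨x, rfl, hx⟩ := (mem_filter.1 ho).2
      exact ⟨x, by simpa using hx, rfl⟩
    · intro x hx
      have hx : α x = x := by simpa using hx
      congr 1
      symm
      rw [card_eq_one]
      refine ⟨x, ext fun y => ?_⟩
      rw [mem_filter, mem_singleton, hq]
      exact ⟨fun h => (h.2.symm.eq_of_left hx).symm, fun h => ⟨mem_univ _, h ▸ .refl _ _⟩⟩
  have hcyc : ∏ c ∈ α.cycleFactorsFinset, F #c.support =
      ∏ o with ¬ ∃ x, q x = o ∧ α x = x, F #{k | q k = o} := by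
    symm
    refine prod_bij (fun o _ => α.cycleOf o.out) ?_ ?_ ?_ ?_
    · intro o ho
      rw [Equiv.Perm.cycleOf_mem_cycleFactorsFinset_iff, Equiv.Perm.mem_support]
      exact fun h => (mem_filter.1 ho).2 ⟨_, Quotient.out_eq o, h⟩
    · intro o ho o' ho' h
      rw [← Quotient.out_eq o, ← Quotient.out_eq o']
      refine hq.2 ?_
      rw [Equiv.Perm.sameCycle_iff_cycleOf_eq_of_mem_support]
      · exact h
      · rw [Equiv.Perm.mem_support]
        exact fun h => (mem_filter.1 ho).2 ⟨_, Quotient.out_eq o, h⟩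
      · rw [Equiv.Perm.mem_support]
        exact fun h => (mem_filter.1 ho').2 ⟨_, Quotient.out_eq o', h⟩
    · intro c hc
      obtain ⟨x, hx⟩ := (Equiv.Perm.mem_cycleFactorsFinset_iff.1 hc).1.nonempty_support
      have hc' := Equiv.Perm.cycle_is_cycleOf hx hc
      have hout : α.SameCycle (q x).out x := hq.1 (Quotient.out_eq (q x))
      refine ⟨q x, ?_, ?_⟩
      · rw [mem_filter]
        refine ⟨mem_univ _, ?_⟩
        rintro ⟨y, hy, hfix⟩
        have hxy := (hq.1 hy).eq_of_left hfix
        subst hxy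
        exact (Equiv.Perm.mem_support.1
          (Equiv.Perm.mem_cycleFactorsFinset_support_le hc hx)) hfix
      · rw [hc', hout.cycleOf_eq]
    · intro o ho
      have hne : α o.out ≠ o.out := fun h => (mem_filter.1 ho).2 ⟨_, Quotient.out_eq o, h⟩
      congr 2
      ext k
      rw [mem_filter, Equiv.Perm.mem_support_cycleOf_iff' hne]
      conv_lhs => rw [← Quotient.out_eq o]
      rw [show (q k = ⟦o.out⟧ ↔ _) from hq]
      exact ⟨fun h => h.2.symm, fun h => ⟨mem_univ _, h.symm⟩⟩
  rw [Equiv.Perm.parts_partition, Multiset.map_add, Multiset.prod_add, Equiv.Perm.cycleType_def,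
    Multiset.map_map, Multiset.map_replicate, Multiset.prod_replicate]
  rw [prod_const, card_sdiff_of_subset (subset_univ _), card_univ] at hfix
  rw [hfix, mul_comm, ← prod_filter_mul_prod_filter_not univ (fun o => ∃ x, q x = o ∧ α x = x)]
  congr 1

end Orbits

section InvariantSum

variable {ι : Type*} [Fintype ι] [DecidableEq ι] {N : ℕ} (K : Type*) [Field K]

/-- The sum of the monomials `∏ₖ x_{f k}` over the functions `f` that are constant on the cycles of
the permutation `α`. -/
noncomputable def invariantSum (N : ℕ) (α : Equiv.Perm ι) : MvPolynomial (Fin N) K :=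
  ∑ f : ι → Fin N with ∀ k, f (α k) = f k, ∏ k, X (f k)

/-- A function constant on the cycles amounts to a choice of a variable for every cycle, so that
the sum factors over the cycles. -/
theorem invariantSum_eq_prod (α : Equiv.Perm ι) :
    invariantSum K N α = (α.partition.parts.map (psum (Fin N) K)).prod := by
  classical
  let q : ι → Quotient (Equiv.Perm.SameCycle.setoid α) := Quotient.mk _
  have hq {x y : ι} : q x = q y ↔ α.SameCycle x y := Quotient.eq
  rw [prod_map_parts_partition]
  simp only [psum]
  rw [Fintype.prod_sum, invariantSum]
  symm
  refine sum_bij' (fun g _ k => g (q k)) (fun f _ o => f o.out) ?_ ?_ ?_ ?_ ?_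
  · intro g _
    refine mem_filter.2 ⟨mem_univ _, fun k => ?_⟩
    exact congrArg g (hq.2 (Equiv.Perm.sameCycle_apply_left.2 (.refl α k)))
  · exact fun _ _ => mem_univ _
  · intro g _
    funext o
    exact congrArg g (Quotient.out_eq o)
  · intro f hf
    have hf := (mem_filter.1 hf).2
    have hpow (m : ℕ) (x : ι) : f ((α ^ m) x) = f x := by
      induction m with
      | zero => rfl
      | succ m ih => rw [pow_succ', Equiv.Perm.mul_apply, hf, ih]
    funext k
    obtain ⟨m, hm⟩ := (hq.1 (Quotient.out_eq (q k))).exists_nat_pow_eq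
    exact (hpow m _).symm.trans (congrArg f hm)
  · intro g _
    rw [← prod_fiberwise univ q]
    refine prod_congr rfl fun o _ => ?_
    rw [prod_congr (g := fun _ => X (g o)) rfl fun k hk =>
      congrArg (fun o => X (g o)) (mem_filter.1 hk).2, prod_const]

theorem invariantSum_eq_psumPart {n : ℕ} (α : Equiv.Perm (Fin n)) :
    invariantSum K N α = psumPart (Fin N) K (cyclePartition α) :=
  invariantSum_eq_prod K α

end InvariantSum

/-! ### The operator on sums over colourings -/

section Pinned

variable {ι : Type*} [Fintype ι] [DecidableEq ι] (K : Type*) [Field K] {N : ℕ}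

/-- The part of `invariantSum K N α` coming from the functions with `f a = i`. -/
noncomputable def pinnedSum (α : Equiv.Perm ι) (a : ι) (i : Fin N) : MvPolynomial (Fin N) K :=
  ∑ f : ι → Fin N with (∀ k, f (α k) = f k) ∧ f a = i, ∏ k, X (f k)

/-- The part of `invariantSum K N (Equiv.swap a b * α)` coming from the functions with `f a = i`
and `f b = j`. -/
noncomputable def doublyPinnedSum (α : Equiv.Perm ι) (a b : ι) (i j : Fin N) :
    MvPolynomial (Fin N) K :=
  ∑ f : ι → Fin N with (∀ k, f (Equiv.swap a b (α k)) = f k) ∧ f a = i ∧ f b = j, ∏ k, X (f k)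

variable {K}

theorem X_mul_prod_X_eq_update (f : ι → Fin N) (b : ι) (i : Fin N) :
    (X i * ∏ k, X (f k) : MvPolynomial (Fin N) K) =
      X (f b) * ∏ k, X (Function.update f b i k) := by
  rw [← mul_prod_erase univ (fun k => X (f k)) (mem_univ b),
    ← mul_prod_erase univ (fun k => X (Function.update f b i k)) (mem_univ b),
    Function.update_self, mul_left_comm]
  congr 2
  exact prod_congr rfl fun k hk => by rw [Function.update_of_ne (ne_of_mem_erase hk)]

/-- Shifting the second cut point of a cycle from `b` to `α b` recolours the single object `b`.
The cut point `a` itself stands, on the left, for the cycle coloured by `j` throughout and, on the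
right, for the cycle coloured by `i` throughout. -/
theorem X_mul_doublyPinnedSum (α : Equiv.Perm ι) (a b : ι) {i j : Fin N} (hij : i ≠ j) :
    X i * (if b = a then pinnedSum K α a j else doublyPinnedSum K α a b i j) =
      X j * (if α b = a then pinnedSum K α a i else doublyPinnedSum K α a (α b) i j) := by
  -- Both index sets are brought into a form that covers the case of the cut point `a` as well;
  -- `f ↦ update f b i` is then a bijection from the left one to the right one.
  have hl : (if b = a then pinnedSum K α a j else doublyPinnedSum K α a b i j) =
      ∑ f : ι → Fin N with f b = j ∧ Function.update f b i a = i ∧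
        ∀ k, f k = if α k = a then j else Function.update f b i (α k), ∏ k, X (f k) := by
    split_ifs with h
    · subst h
      refine sum_congr (filter_congr fun f _ => ?_) fun _ _ => rfl
      simp only [Function.update_apply]
      grind
    · refine sum_congr (filter_congr fun f _ => ?_) fun _ _ => rfl
      simp only [Function.update_apply, Equiv.swap_apply_def]
      grind
  have hr : (if α b = a then pinnedSum K α a i else doublyPinnedSum K α a (α b) i j) =
      ∑ f : ι → Fin N with f a = i ∧ f b = i ∧ (α b ≠ a → f (α b) = j) ∧
        ∀ k, k ≠ b → f k = if α k = a then j else f (α k), ∏ k, X (f k) := by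
    have hα (k : ι) : α k = α b ↔ k = b := α.injective.eq_iff
    split_ifs with h
    · refine sum_congr (filter_congr fun f _ => ?_) fun _ _ => rfl
      grind
    · refine sum_congr (filter_congr fun f _ => ?_) fun _ _ => rfl
      simp only [Equiv.swap_apply_def]
      grind
  rw [hl, hr, mul_sum, mul_sum]
  refine sum_bij' (fun f _ => Function.update f b i) (fun f _ => Function.update f b j)
    ?_ ?_ ?_ ?_ ?_
  · intro f hf
    simp only [mem_filter, mem_univ, true_and, Function.update_apply] at hf ⊢
    grind
  · intro f hf
    simp only [mem_filter, mem_univ, true_and, Function.update_apply] at hf ⊢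
    grind
  · intro f hf
    simp only [mem_filter, mem_univ, true_and] at hf
    rw [Function.update_idem, ← hf.1, Function.update_eq_self]
  · intro f hf
    simp only [mem_filter, mem_univ, true_and] at hf
    rw [Function.update_idem, ← hf.2.1, Function.update_eq_self]
  · intro f hf
    simp only [mem_filter, mem_univ, true_and] at hf
    rw [X_mul_prod_X_eq_update f b i, hf.1]

/-- Summing `X_mul_doublyPinnedSum` over all `b` divides `xᵢ Wᵢ - xⱼ Wⱼ` by `xᵢ - xⱼ`, where
`Wᵢ = pinnedSum K α a i`. -/
theorem X_mul_pinnedSum_sub (α : Equiv.Perm ι) (a : ι) {i j : Fin N} (hij : i ≠ j) :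
    X i * pinnedSum K α a i - X j * pinnedSum K α a j =
      (X i - X j) * (pinnedSum K α a i + pinnedSum K α a j +
        ∑ b with b ≠ a, doublyPinnedSum K α a b i j) := by
  have h := sum_congr (rfl : (univ : Finset ι) = univ)
    fun b _ => X_mul_doublyPinnedSum (K := K) α a b hij
  rw [← mul_sum, ← mul_sum, Equiv.sum_comp α
    (fun b => if b = a then pinnedSum K α a i else doublyPinnedSum K α a b i j)] at h
  simp only [sum_ite, filter_eq', mem_univ, if_true, sum_singleton] at h
  linear_combination -h

end Pinned

section Operator

variable {ι : Type*} [Fintype ι] {K : Type*} [Field K] {N : ℕ}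

theorem X_mul_pderiv_prod_X (f : ι → Fin N) (i : Fin N) :
    X i * pderiv i (∏ k, X (f k) : MvPolynomial (Fin N) K) =
      (#{k | f k = i} : MvPolynomial (Fin N) K) * ∏ k, X (f k) := by
  have h : (∏ k, X (f k) : MvPolynomial (Fin N) K) =
      monomial (∑ k, Finsupp.single (f k) 1) 1 := by
    rw [monomial_sum_one]; rfl
  rw [h, X_mul_pderiv_monomial, nsmul_eq_mul]
  congr 2
  rw [Finsupp.finsetSum_apply, card_filter]
  exact sum_congr rfl fun k _ => Finsupp.single_apply

theorem X_sq_mul_pderiv_pderiv_prod_X (f : ι → Fin N) (i : Fin N) :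
    X i ^ 2 * pderiv i (pderiv i (∏ k, X (f k) : MvPolynomial (Fin N) K)) =
      ((#{k | f k = i} : MvPolynomial (Fin N) K) ^ 2 -
        (#{k | f k = i} : MvPolynomial (Fin N) K)) * ∏ k, X (f k) := by
  -- `xᵢ² ∂ᵢ² = (xᵢ ∂ᵢ)² - xᵢ ∂ᵢ`
  have h := congrArg (fun p => X i * pderiv i p) (X_mul_pderiv_prod_X (K := K) f i)
  have hc : pderiv i ((#{k | f k = i} : ℕ) : MvPolynomial (Fin N) K) = 0 := by
    rw [← map_natCast C, pderiv_C]
  simp only [pderiv_mul, pderiv_X_self, hc] at h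
  have h' := X_mul_pderiv_prod_X (K := K) f i
  linear_combination h + ((#{k | f k = i} : ℕ) - 1 : MvPolynomial (Fin N) K) * h'

variable [DecidableEq ι]

/-- On the monomial of a colouring `f`, the operator `∑ᵢ xᵢ² ∂ᵢ²` counts the ordered pairs of
distinct objects of the same colour. -/
theorem sum_X_sq_mul_pderiv_pderiv_invariantSum (α : Equiv.Perm ι) :
    ∑ i, X i ^ 2 * pderiv i (pderiv i (invariantSum K N α)) =
      ∑ a, ∑ b with b ≠ a,
        ∑ f : ι → Fin N with (∀ k, f (α k) = f k) ∧ f b = f a, ∏ k, X (f k) := by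
  have hcount (f : ι → Fin N) :
      ∑ i, ((#{k | f k = i} : MvPolynomial (Fin N) K) ^ 2 -
        (#{k | f k = i} : MvPolynomial (Fin N) K)) =
        ∑ a, ∑ b with b ≠ a, if f b = f a then 1 else 0 := by
    have h1 (a : ι) : (∑ b with b ≠ a, if f b = f a then (1 : MvPolynomial (Fin N) K) else 0) =
        ∑ i, (if f a = i then ((#{k | f k = i} : MvPolynomial (Fin N) K) - 1) else 0) := by
      rw [sum_ite_eq univ (f a), if_pos (mem_univ _), card_filter, Nat.cast_sum, filter_ne',
        ← add_sum_erase univ _ (mem_univ a)]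
      simp
    rw [sum_congr rfl fun a _ => h1 a, sum_comm]
    refine sum_congr rfl fun i _ => ?_
    rw [← sum_filter, sum_const, nsmul_eq_mul]
    ring
  simp only [invariantSum, map_sum, mul_sum, X_sq_mul_pderiv_pderiv_prod_X]
  rw [sum_comm, sum_congr rfl fun f _ => by rw [← sum_mul, hcount f]]
  simp only [sum_mul, ite_mul, one_mul, zero_mul]
  rw [sum_comm]
  refine sum_congr rfl fun a _ => ?_
  rw [sum_comm]
  refine sum_congr rfl fun b _ => ?_
  rw [← sum_filter, filter_filter]

theorem X_sq_mul_pderiv_invariantSum (α : Equiv.Perm ι) (i : Fin N) :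
    X i ^ 2 * pderiv i (invariantSum K N α) = X i * ∑ a, pinnedSum K α a i := by
  have h (f : ι → Fin N) : X i ^ 2 * pderiv i (∏ k, X (f k) : MvPolynomial (Fin N) K) =
      X i * ∑ a, if f a = i then ∏ k, X (f k) else 0 := by
    rw [pow_two, mul_assoc, X_mul_pderiv_prod_X, ← sum_filter, sum_const, nsmul_eq_mul]
  rw [invariantSum, map_sum, mul_sum, sum_congr rfl fun f _ => h f, ← mul_sum, sum_comm]
  congr 1
  refine sum_congr rfl fun a _ => ?_
  rw [← sum_filter, filter_filter, pinnedSum]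

theorem sum_pinnedSum (α : Equiv.Perm ι) (a : ι) :
    ∑ i, pinnedSum K α a i = invariantSum K N α := by
  simp only [pinnedSum, ← filter_filter]
  exact sum_fiberwise _ _ _

/-- A function that is constant on the cycles of `(a b) α` either takes the same value at `a` and
`b`, and then it is constant on the cycles of `α`, or two different ones. -/
theorem invariantSum_swap_mul (α : Equiv.Perm ι) (a b : ι) :
    invariantSum K N (Equiv.swap a b * α) =
      (∑ f : ι → Fin N with (∀ k, f (α k) = f k) ∧ f b = f a, ∏ k, X (f k)) +
        ∑ i, ∑ j with j ≠ i, doublyPinnedSum K α a b i j := by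
  rw [invariantSum, ← sum_filter_add_sum_filter_not _ (fun f => f b = f a), filter_filter,
    filter_filter]
  congr 1
  · refine sum_congr (filter_congr fun f _ => and_congr_left fun h => ?_) fun _ _ => rfl
    refine forall_congr' fun k => ?_
    simp only [Equiv.Perm.mul_apply, Equiv.swap_apply_def]
    grind
  · rw [← sum_fiberwise _ (fun f => f a)]
    refine sum_congr rfl fun i _ => ?_
    rw [filter_filter, ← sum_fiberwise_of_maps_to (t := univ.filter (· ≠ i)) (g := fun f => f b)]
    · refine sum_congr rfl fun j hj => ?_
      rw [filter_filter]
      refine sum_congr (filter_congr fun f _ => ?_) fun _ _ => rfl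
      have hj := (mem_filter.1 hj).2
      simp only [Equiv.Perm.mul_apply]
      grind
    · intro f hf
      simp only [mem_filter, mem_univ, true_and] at hf ⊢
      grind

theorem dStar_invariantSum (α : Equiv.Perm ι) :
    dStar (invariantSum K N α) = algebraMap _ _
      (2 * (Fintype.card ι * (N - 1)) * invariantSum K N α +
        ∑ a, ∑ b with b ≠ a, invariantSum K N (Equiv.swap a b * α)) := by
  have hquot (i j : Fin N) : (if i = j then 0 else
      algebraMap (MvPolynomial (Fin N) K) (FractionRing (MvPolynomial (Fin N) K))
        (X i ^ 2 * pderiv i (invariantSum K N α) - X j ^ 2 * pderiv j (invariantSum K N α)) /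
      algebraMap (MvPolynomial (Fin N) K) (FractionRing (MvPolynomial (Fin N) K)) (X i - X j)) =
      algebraMap _ _ (if j ≠ i then ∑ a, (pinnedSum K α a i + pinnedSum K α a j +
        ∑ b with b ≠ a, doublyPinnedSum K α a b i j) else 0) := by
    rcases eq_or_ne i j with rfl | hij
    · simp
    rw [if_neg hij, if_pos hij.symm, div_eq_iff, ← map_mul]
    · congr 1
      rw [X_sq_mul_pderiv_invariantSum, X_sq_mul_pderiv_invariantSum, mul_sum, mul_sum,
        ← sum_sub_distrib, sum_mul]
      exact sum_congr rfl fun a _ => by rw [X_mul_pinnedSum_sub α a hij, mul_comm]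
    · rw [Ne, FaithfulSMul.algebraMap_eq_zero_iff, sub_eq_zero]
      exact fun h => hij (X_injective h)
  have hpin (a : ι) : ∑ i : Fin N, ∑ j with j ≠ i, (pinnedSum K α a i + pinnedSum K α a j) =
      2 * (N - 1) * invariantSum K N α := by
    have h (i : Fin N) : ∑ j with j ≠ i, (pinnedSum K α a i + pinnedSum K α a j) =
        (N - 2) * pinnedSum K α a i + invariantSum K N α := by
      have h1 := add_sum_erase univ (fun j => pinnedSum K α a i + pinnedSum K α a j) (mem_univ i)
      rw [← filter_ne', sum_add_distrib (s := univ), sum_const, sum_pinnedSum, card_univ,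
        Fintype.card_fin, nsmul_eq_mul] at h1
      linear_combination h1
    simp only [h]
    rw [sum_add_distrib, ← mul_sum, sum_pinnedSum, sum_const, card_univ, Fintype.card_fin,
      nsmul_eq_mul]
    ring
  rw [dStar]
  simp only [hquot]
  simp only [← map_sum, ← map_add]
  congr 1
  rw [sum_X_sq_mul_pderiv_pderiv_invariantSum]
  simp only [← sum_filter, invariantSum_swap_mul, sum_add_distrib]
  have hcomm : ∑ i : Fin N, ∑ j with j ≠ i, ∑ a, (pinnedSum K α a i + pinnedSum K α a j) =
      2 * (Fintype.card ι * (N - 1)) * invariantSum K N α := by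
    rw [sum_congr rfl fun i _ => sum_comm, sum_comm, sum_congr rfl fun a _ => hpin a, sum_const,
      card_univ, nsmul_eq_mul]
    ring
  have hcomm' : ∑ i : Fin N, ∑ j with j ≠ i, ∑ a, ∑ b with b ≠ a, doublyPinnedSum K α a b i j =
      ∑ a, ∑ b with b ≠ a, ∑ i : Fin N, ∑ j with j ≠ i, doublyPinnedSum K α a b i j := by
    rw [sum_congr rfl fun i _ => sum_comm, sum_comm]
    refine sum_congr rfl fun a _ => ?_
    rw [sum_congr rfl fun i _ => sum_comm, sum_comm]
  simp only [sum_add_distrib] at hcomm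
  rw [← hcomm, hcomm']
  ring

end Operator

/-! ### Sums over transpositions -/

section Transpositions

/-- Every transposition is `swap a b` for exactly two ordered pairs `(a, b)` with `a ≠ b`. -/
theorem sum_swap_eq_two_nsmul {ι M : Type*} [Fintype ι] [DecidableEq ι] [AddCommMonoid M]
    (G : Equiv.Perm ι → M) [DecidablePred (Equiv.Perm.IsSwap (α := ι))] :
    ∑ a, ∑ b with b ≠ a, G (Equiv.swap a b) = 2 • ∑ π with π.IsSwap, G π := by
  have h : ∑ a, ∑ b with b ≠ a, G (Equiv.swap a b) =
      ∑ p ∈ univ.filter (fun p : ι × ι => p.2 ≠ p.1), G (Equiv.swap p.1 p.2) := by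
    simp only [sum_filter, Fintype.sum_prod_type]
  rw [h, ← sum_fiberwise_of_maps_to (t := univ.filter Equiv.Perm.IsSwap)
    (g := fun p : ι × ι => Equiv.swap p.1 p.2), smul_sum]
  · refine sum_congr rfl fun π hπ => ?_
    obtain ⟨a, b, hab, rfl⟩ := (mem_filter.1 hπ).2
    rw [sum_congr rfl fun p hp => by rw [(mem_filter.1 hp).2], sum_const]
    congr 1
    rw [← card_pair (show (a, b) ≠ (b, a) from fun h => hab (congrArg Prod.fst h))]
    congr 1
    ext ⟨c, d⟩
    simp only [mem_filter, mem_univ, true_and, mem_insert, mem_singleton, Prod.mk.injEq]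
    constructor
    · rintro ⟨hdc, h⟩
      have h1 := Equiv.swap_apply_left c d
      have h2 := Equiv.swap_apply_right c d
      rw [h, Equiv.swap_apply_def] at h1 h2
      grind
    · rintro (⟨rfl, rfl⟩ | ⟨rfl, rfl⟩)
      exacts [⟨hab.symm, rfl⟩, ⟨hab, Equiv.swap_comm _ _⟩]
  · intro p hp
    exact mem_filter.2 ⟨mem_univ _, p.1, p.2, (mem_filter.1 hp).2.symm, rfl⟩

theorem sum_isSwap_eq_sum_transpositionCount {M : Type*} [AddCommMonoid M] {n : ℕ}
    (α : Equiv.Perm (Fin n)) (F : n.Partition → M)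
    [DecidablePred (Equiv.Perm.IsSwap (α := Fin n))] :
    ∑ π with π.IsSwap, F (cyclePartition (π * α)) = ∑ s, transpositionCount α s • F s := by
  rw [← sum_fiberwise _ (fun π => cyclePartition (π * α))]
  refine sum_congr rfl fun s _ => ?_
  rw [sum_congr rfl fun π hπ => by rw [(mem_filter.1 hπ).2], sum_const, filter_filter,
    transpositionCount, Nat.card_eq_fintype_card, Fintype.card_subtype]

/-- The action of `D*` on power sum products. -/
theorem dStar_psumPart {K : Type*} [Field K] {N n : ℕ} (l : n.Partition) :
    dStar (psumPart (Fin N) K l) = algebraMap _ _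
      (2 * ((n * (N - 1)) * psumPart (Fin N) K l +
        ∑ s, (transpositionMatrix n l s : MvPolynomial (Fin N) K) * psumPart (Fin N) K s)) := by
  classical
  obtain ⟨α, rfl⟩ := exists_cyclePartition_eq l
  rw [← invariantSum_eq_psumPart, dStar_invariantSum,
    sum_swap_eq_two_nsmul fun π => invariantSum K N (π * α)]
  simp only [invariantSum_eq_psumPart (K := K) (_ * α)]
  rw [sum_isSwap_eq_sum_transpositionCount α (psumPart (Fin N) K)]
  simp only [transpositionMatrix_apply, nsmul_eq_mul, Fintype.card_fin]
  congr 1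
  push_cast
  ring

end Transpositions

/-! ### Linearity of the operator and its matrix -/

section Linearity

variable {K : Type*} [Field K] {N : ℕ}

theorem dStar_add (f g : MvPolynomial (Fin N) K) : dStar (f + g) = dStar f + dStar g := by
  have h (i j : Fin N) (x y z : FractionRing (MvPolynomial (Fin N) K)) :
      (if i = j then 0 else (x + y) / z) =
        (if i = j then 0 else x / z) + if i = j then 0 else y / z := by
    split_ifs
    · rw [add_zero]
    · rw [add_div]
  simp only [dStar, map_add, mul_add, add_sub_add_comm, h, sum_add_distrib]
  exact add_add_add_comm _ _ _ _

theorem dStar_smul (c : K) (f : MvPolynomial (Fin N) K) : dStar (c • f) = c • dStar f := by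
  simp only [dStar, Derivation.map_smul, mul_smul_comm, ← smul_sub, algebraMap.coe_smul,
    smul_div_assoc, smul_add, smul_sum, smul_ite, smul_zero]

end Linearity

theorem mainTheorem4 {K : Type*} [Field K] [CharZero K] (N n : ℕ) (hN : n < N) :
    ∃ b : Module.Basis n.Partition K (symmetricHomogeneous K N n),
      (∀ l : n.Partition,
        (b l : MvPolynomial (Fin N) K) = MvPolynomial.psumPart (Fin N) K l) ∧
      ∃ D : symmetricHomogeneous K N n →ₗ[K] symmetricHomogeneous K N n,
        (∀ f : symmetricHomogeneous K N n,
          algebraMap (MvPolynomial (Fin N) K) (FractionRing (MvPolynomial (Fin N) K))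
            (D f : MvPolynomial (Fin N) K) = dStar (f : MvPolynomial (Fin N) K)) ∧
        LinearMap.toMatrix b b ((1 / 2 : K) • D) =
          ((transpositionMatrix n).map (Nat.cast : ℕ → K)).transpose +
            ((n : K) * ((N : K) - 1)) • (1 : Matrix n.Partition n.Partition K) := by
  let b := psumBasis K hN.le
  have hb (l : n.Partition) : (b l : MvPolynomial (Fin N) K) = psumPart (Fin N) K l :=
    coe_psumBasis hN.le l
  let M : Matrix n.Partition n.Partition K :=
    ((transpositionMatrix n).map (Nat.cast : ℕ → K)).transpose +
      ((n : K) * ((N : K) - 1)) • (1 : Matrix n.Partition n.Partition K)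
  let D := (2 : K) • Matrix.toLin b b M
  let dStarLin : MvPolynomial (Fin N) K →ₗ[K] FractionRing (MvPolynomial (Fin N) K) :=
    { toFun := dStar, map_add' := dStar_add, map_smul' := dStar_smul }
  have hD : (Algebra.linearMap (MvPolynomial (Fin N) K)
        (FractionRing (MvPolynomial (Fin N) K))).restrictScalars K ∘ₗ
        (symmetricHomogeneous K N n).subtype ∘ₗ D =
      dStarLin ∘ₗ (symmetricHomogeneous K N n).subtype := by
    refine b.ext fun l => ?_
    change algebraMap _ _ (D (b l) : MvPolynomial (Fin N) K) =
      dStar (b l : MvPolynomial (Fin N) K)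
    rw [hb, dStar_psumPart]
    congr 1
    have hdiag : ∑ s, (n * (N - 1) * (1 : Matrix n.Partition n.Partition K) s l) •
        psumPart (Fin N) K s = (n * (N - 1) : K) • psumPart (Fin N) K l := by
      rw [sum_eq_single l]
      · simp
      · intro s _ h; simp [Matrix.one_apply_ne h]
      · simp
    have hsum : (D (b l) : MvPolynomial (Fin N) K) =
        (2 : K) • ∑ s, M s l • psumPart (Fin N) K s := by
      simp only [D, LinearMap.smul_apply, Matrix.toLin_self, Submodule.coe_smul,
        AddSubmonoidClass.coe_finsetSum, hb]
    rw [hsum]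
    simp only [M, Matrix.add_apply, Matrix.smul_apply, Matrix.transpose_apply, Matrix.map_apply,
      add_smul, sum_add_distrib, smul_eq_mul, hdiag]
    simp only [smul_eq_C_mul, map_natCast, map_mul, map_sub, map_one, map_ofNat]
    ring
  refine ⟨b, hb, D, fun f => LinearMap.congr_fun hD f, ?_⟩
  simp only [D, smul_smul]
  rw [one_div_mul_cancel two_ne_zero, one_smul, LinearMap.toMatrix_toLin]
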